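/- Let $\alpha>0$, $\lambda>1/\alpha$, $\beta>0$, $\overline{\gamma}>0$. Let $\tau$ be a Gamma random variable with density $\frac{\beta^{\lambda}}{\Gamma(\lambda)}t^{\lambda-1}e^{-\beta t}$, $t>0$, and let $X,Y$ be real random variables which, conditionally on $\tau$, are independent centred Gaussians of variance $\frac{1}{2\tau}$. Put $H=(X^2+Y^2)^{1/\alpha}$ (the $\alpha$-Lomax fading variable) and let $\mathbf{\Gamma}=\overline{\gamma}\,H/\mathbb{E}[H]$ be the instantaneous SNR with average $\overline{\gamma}$. Put $$\zeta=\left(\frac{\Gamma(1+\frac1\alpha)\,\Gamma(\lambda-\frac1\alpha)}{\Gamma(\lambda)}\right)^{\alpha}.$$ Then $\mathbf{\Gamma}$ has the probability density $$f_{\mathbf\Gamma}(\gamma)=\frac{\alpha\lambda\zeta}{\overline{\gamma}^{\alpha}}\,\gamma^{\alpha-1}\left(1+\frac{\zeta}{\overline{\gamma}^{\alpha}}\gamma^{\alpha}\right)^{-(\lambda+1)}\quad(\gamma>0),\qquad f_{\mathbf\Gamma}(\gamma)=0\quad(\gamma\le 0),$$ and for every integer $n\ge 0$ and every real $s>0$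 its generalized moment generating function $\mathcal{M}^{n}_{\mathbf\Gamma}(s)=\int_0^\infty \gamma^{n} f_{\mathbf\Gamma}(\gamma)e^{-s\gamma}\,d\gamma$ converges and $$\mathcal{M}^{n}_{\mathbf\Gamma}(s)=\frac{\alpha}{s^{n}\,\Gamma(\lambda)}\;\mathsf{H}^{1,2}_{2,1}\!\left[\frac{\zeta}{\overline{\gamma}^{\alpha}s^{\alpha}}\,\middle|\,\begin{matrix}(1-\lambda,1),(1-n,\alpha)\\(1,1)\end{matrix}\right].$$ Here $\mathsf{H}^{m,k}_{p,q}$ is the Fox H-function $$\mathsf{H}^{m,k}_{p,q}\!\left[z\,\middle|\,\begin{matrix}(a_1,A_1),\dots,(a_p,A_p)\\(b_1,B_1),\dots,(b_q,B_q)\end{matrix}\right]=\frac{1}{2\pi i}\int_{L}\frac{\prod_{j\le m}\Gamma(b_j+B_ju)\,\prod_{i\le k}\Gamma(1-a_i-A_iu)}{\prod_{i>k}\Gamma(a_i+A_iu)\,\prod_{j>m}\Gamma(1-b_j-B_ju)}\,z^{-u}\,du,$$ where $L$ is a vertical line, directed upwards, that separates the poles of the $\Gamma(b_j+B_ju)$,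 $j\le m$ (on its left), from those of the $\Gamma(1-a_i-A_iu)$, $i\le k$ (on its right). For the parameters above such lines exist, and along each of them the integral converges absolutely and has the same value. -/

import Mathlib

open MeasureTheory ProbabilityTheory

noncomputable section

namespace AlphaLomax

/-! ### The Fox H-function -/

/-- The Mellin–Barnes kernel of the Fox function `H^{m,n}_{p,q}` with upper parameters
`(a i, A i)`, `i < p`, and lower parameters `(b j, B j)`, `j < q`:
`∏_{j<m} Γ(b_j + B_j s) ∏_{i<n} Γ(1 - a_i - A_i s) /
  (∏_{i≥n} Γ(a_i + A_i s) ∏_{j≥m} Γ(1 - b_j - B_j s))`. -/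
def foxKernel (m n : ℕ) {p q : ℕ} (a : Fin p → ℂ) (A : Fin p → ℝ) (b : Fin q → ℂ) (B : Fin q → ℝ)
    (s : ℂ) : ℂ :=
  ((∏ j : Fin q with j.val < m, Complex.Gamma (b j + B j * s)) *
      ∏ i : Fin p with i.val < n, Complex.Gamma (1 - a i - A i * s)) /
    ((∏ i : Fin p with n ≤ i.val, Complex.Gamma (a i + A i * s)) *
      ∏ j : Fin q with m ≤ j.val, Complex.Gamma (1 - b j - B j * s))

/-- The poles of the factors `Γ(b_j + B_j s)`, `j < m`. -/
def leftPoles (m : ℕ) {q : ℕ} (b : Fin q → ℂ) (B : Fin q → ℝ) : Set ℂ :=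
  {s | ∃ j : Fin q, j.val < m ∧ ∃ k : ℕ, b j + B j * s = -(k : ℂ)}

/-- The poles of the factors `Γ(1 - a_i - A_i s)`, `i < n`. -/
def rightPoles (n : ℕ) {p : ℕ} (a : Fin p → ℂ) (A : Fin p → ℝ) : Set ℂ :=
  {s | ∃ i : Fin p, i.val < n ∧ ∃ k : ℕ, 1 - a i - A i * s = -(k : ℂ)}

/-- The vertical line `Re s = σ` separates the left poles from the right poles. -/
def IsSeparatingLine (m n : ℕ) {p q : ℕ} (a : Fin p → ℂ) (A : Fin p → ℝ) (b : Fin q → ℂ)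
    (B : Fin q → ℝ) (σ : ℝ) : Prop :=
  (∀ s ∈ leftPoles m b B, s.re < σ) ∧ ∀ s ∈ rightPoles n a A, σ < s.re

/-- The integrand `foxKernel s * z ^ (-s)` on the line `s = σ + i t`. -/
def foxIntegrand (m n : ℕ) {p q : ℕ} (a : Fin p → ℂ) (A : Fin p → ℝ) (b : Fin q → ℂ)
    (B : Fin q → ℝ) (z : ℂ) (σ t : ℝ) : ℂ :=
  foxKernel m n a A b B (σ + t * Complex.I) * z ^ (-(σ + t * Complex.I))

/-- `w` is the value at `z` of the Fox function `H^{m,n}_{p,q}`: some vertical line separates the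
two families of poles, and along every such line `(1 / (2 π i)) ∫ foxKernel s * z ^ (-s) ds`
converges absolutely and equals `w` (on `s = σ + i t` one has `ds = i dt`). -/
def HasFoxH (m n : ℕ) {p q : ℕ} (a : Fin p → ℂ) (A : Fin p → ℝ) (b : Fin q → ℂ) (B : Fin q → ℝ)
    (z w : ℂ) : Prop :=
  (∃ σ : ℝ, IsSeparatingLine m n a A b B σ) ∧
    ∀ σ : ℝ, IsSeparatingLine m n a A b B σ →
      Integrable (foxIntegrand m n a A b B z σ) ∧
        1 / (2 * (Real.pi : ℂ)) * ∫ t : ℝ, foxIntegrand m n a A b B z σ t = w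

open Classical in
/-- The Fox H-function (with value `0` where the Mellin–Barnes integral does not define it). -/
def foxH (m n : ℕ) {p q : ℕ} (a : Fin p → ℂ) (A : Fin p → ℝ) (b : Fin q → ℂ) (B : Fin q → ℝ)
    (z : ℂ) : ℂ :=
  if h : ∃ w, HasFoxH m n a A b B z w then h.choose else 0

/-! ### The `α`-Lomax fading model -/

/-- The physical model of Lomax fading: `τ` is Gamma distributed with density
`β ^ lam / Γ(lam) * t ^ (lam - 1) * exp (-β t)`, and given `τ = t` the components `X`, `Y` are
independent centred Gaussians of variance `1 / (2 t)`. -/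
structure IsLomaxFading {Ω : Type*} [MeasurableSpace Ω] (P : Measure Ω) [IsFiniteMeasure P]
    (lam β : ℝ) (τ X Y : Ω → ℝ) : Prop where
  aemeasurable_fst : AEMeasurable X P
  aemeasurable_snd : AEMeasurable Y P
  hasLaw : HasLaw τ (gammaMeasure lam β) P
  condDistrib_eq : ∀ᵐ t ∂(P.map τ), condDistrib (fun ω => (X ω, Y ω)) τ P t =
    (gaussianReal 0 (1 / (2 * t)).toNNReal).prod (gaussianReal 0 (1 / (2 * t)).toNNReal)

/-- The `α`-Lomax variable `H = P ^ (1 / α)`, where `P = X ^ 2 + Y ^ 2` is the signal power. -/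
def fadingGain {Ω : Type*} (α : ℝ) (X Y : Ω → ℝ) (ω : Ω) : ℝ :=
  (X ω ^ 2 + Y ω ^ 2) ^ (1 / α)

/-- The instantaneous SNR `γbar * Z` with `Z = H / E[H]`. -/
def snr {Ω : Type*} [MeasurableSpace Ω] (P : Measure Ω) (α γbar : ℝ) (X Y : Ω → ℝ) (ω : Ω) : ℝ :=
  γbar * (fadingGain α X Y ω / ∫ ω', fadingGain α X Y ω' ∂P)

/-- `ζ = (Γ(1 + 1/α) Γ(lam - 1/α) / Γ(lam)) ^ α`. -/
def zeta (α lam : ℝ) : ℝ :=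
  (Real.Gamma (1 + 1 / α) * Real.Gamma (lam - 1 / α) / Real.Gamma lam) ^ α

/-- The explicit density of the instantaneous SNR, supported on `(0, ∞)`. -/
def snrPDF (α lam γbar γ : ℝ) : ℝ :=
  if 0 < γ then
    α * lam * zeta α lam / γbar ^ α * γ ^ (α - 1) *
      (1 + zeta α lam / γbar ^ α * γ ^ α) ^ (-(lam + 1))
  else 0

/-- The integrand `γ ^ n * f_G(γ) * exp (-γ s)`, where `f_G` is the density of `G`. -/
def genMGFIntegrand {Ω : Type*} [MeasurableSpace Ω] (P : Measure Ω) (G : Ω → ℝ) (n : ℕ)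
    (s γ : ℝ) : ℝ :=
  γ ^ n * (pdf G P volume γ).toReal * Real.exp (-(γ * s))

/-- The generalized moment generating function `∫_0^∞ γ ^ n f_G(γ) exp (-γ s) dγ` of a nonnegative
random variable `G` with density `f_G`. -/
def genMGF {Ω : Type*} [MeasurableSpace Ω] (P : Measure Ω) (G : Ω → ℝ) (n : ℕ) (s : ℝ) : ℝ :=
  ∫ γ in Set.Ioi 0, genMGFIntegrand P G n s γ

end AlphaLomax

end

namespace AlphaLomax

/-! Law of the SNR: given `τ = t`, the power `X² + Y²` is exponential of rate `t`, and mixing over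
the Gamma law of `t` gives the Lomax density `powerPDF` (`IsLomaxFading.lintegral_power`). Its
moment of order `1/α` is a beta integral, so the mean gain is `(β ζ)^(1/α)`. The substitution `v = β
ζ γ^α / γbar^α` then yields the density, with `β` cancelling (`IsLomaxFading.map_snr`).

Transform: put `c = ζ / γbar^α`. The beta integral says that `Γ(w) Γ(a - w) / Γ(a)` is the Mellin
transform of `(1 + x)^(-a)`. Mellin inversion with `a = lam + 1`, `w = 1 + u`, `x = c γ^α` writes
the density as a line integral of `Γ(1 + u) Γ(lam - u)` against powers of `γ`. Integrating these
against `γ^n exp(-sγ)` produces the third factor `Γ(n - αu)`, hence the Fox kernel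
(`integrable_foxIntegrand_lomax`). Fubini applies because `Γ` decays quadratically on vertical lines
and the separating lines are exactly those with `-1 < σ < lam` and `ασ < n`. -/

/-! ### Gamma integrals and the Mellin–Barnes formula for `(1 + x)^(-a)` -/

lemma norm_Gamma_le_Gamma_re {s : ℂ} (hs : 0 < s.re) : ‖Complex.Gamma s‖ ≤ Real.Gamma s.re := by
  rw [Complex.Gamma_eq_integral hs, Real.Gamma_eq_integral hs, Complex.GammaIntegral]
  refine (norm_integral_le_integral_norm _).trans (le_of_eq ?_)
  refine setIntegral_congr_fun measurableSet_Ioi fun x hx => ?_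
  simp only [norm_mul, Complex.norm_real, Complex.norm_cpow_eq_rpow_re_of_pos hx,
    Real.norm_eq_abs, Real.abs_exp, Complex.sub_re, Complex.one_re]

lemma integrableOn_rpow_mul_exp_neg_mul {a r : ℝ} (ha : 0 < a) (hr : 0 < r) :
    IntegrableOn (fun x : ℝ => x ^ (a - 1) * Real.exp (-(r * x))) (Set.Ioi 0) := by
  have : 0 < Real.Gamma a := Real.Gamma_pos_of_pos ha
  -- A non-integrable function has Bochner integral `0`, so the nonzero closed form proves
  -- integrability.
  exact .of_integral_ne_zero (by rw [Real.integral_rpow_mul_exp_neg_mul_Ioi ha hr]; positivity)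

lemma integrableOn_cpow_mul_exp_neg_mul {a : ℂ} {r : ℝ} (ha : 0 < a.re) (hr : 0 < r) :
    IntegrableOn (fun x : ℝ => (x : ℂ) ^ (a - 1) * Complex.exp (-(r * x))) (Set.Ioi 0) := by
  refine (integrableOn_rpow_mul_exp_neg_mul ha hr).mono' ?_ ?_
  · exact Measurable.aestronglyMeasurable (by fun_prop)
  · refine (ae_restrict_iff' measurableSet_Ioi).2 (.of_forall fun x hx => le_of_eq ?_)
    rw [norm_mul, Complex.norm_cpow_eq_rpow_re_of_pos hx, Complex.norm_exp]
    simp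

/-- The beta integral in the form of a Mellin transform. -/
lemma hasMellin_one_add_rpow_neg {a : ℝ} {w : ℂ} (hw : 0 < w.re) (hwa : w.re < a) :
    HasMellin (fun x : ℝ => (((1 + x) ^ (-a) : ℝ) : ℂ)) w
      (Complex.Gamma w * Complex.Gamma (a - w) / Complex.Gamma a) := by
  have ha : 0 < a := hw.trans hwa
  have hΓ : Complex.Gamma a ≠ 0 := Complex.Gamma_ne_zero_of_re_pos (by simpa using ha)
  -- Expand `Γ(a) (1 + x)^(-a)` as a Gamma integral in `y`. In the other order, `x` gives `Γ(w)
  -- y^(-w)` and then `y` gives `Γ(a - w)`.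
  set F : ℝ × ℝ → ℂ := fun p =>
    (p.1 : ℂ) ^ (w - 1) * ((p.2 : ℂ) ^ ((a : ℂ) - 1) * Complex.exp (-(((1 + p.1 : ℝ) : ℂ) * p.2)))
    with hF
  set μ : Measure ℝ := volume.restrict (Set.Ioi 0) with hμ
  have hmeas : Measurable F := by fun_prop
  have hF2 : ∀ x y : ℝ, F (x, y) = ((y : ℂ) ^ ((a : ℂ) - 1) * Complex.exp (-y)) *
      ((x : ℂ) ^ (w - 1) * Complex.exp (-(y * x))) := by
    intro x y
    have : Complex.exp (-(((1 + x : ℝ) : ℂ) * y)) =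
      Complex.exp (-y) * Complex.exp (-(y * x)) := by
      rw [← Complex.exp_add]; congr 1; push_cast; ring
    simp only [hF, this]; ring
  have hInt : Integrable F (μ.prod μ) := by
    rw [integrable_prod_iff' hmeas.aestronglyMeasurable]
    constructor
    · refine (ae_restrict_iff' measurableSet_Ioi).2 (.of_forall fun y hy => ?_)
      simp only [hF2]
      exact (integrableOn_cpow_mul_exp_neg_mul hw hy).const_mul _
    · have h1 : IntegrableOn (fun y : ℝ => y ^ ((a - w.re) - 1) * Real.exp (-(1 * y)) *
          Real.Gamma w.re) (Set.Ioi 0) :=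
        (integrableOn_rpow_mul_exp_neg_mul (sub_pos.2 hwa) one_pos).mul_const _
      refine h1.congr ((ae_restrict_iff' measurableSet_Ioi).2 (.of_forall fun y hy => ?_))
      have hy : 0 < y := hy
      have h2 : ∀ x ∈ Set.Ioi (0 : ℝ), ‖F (x, y)‖ =
          (y ^ (a - 1) * Real.exp (-y)) * (x ^ (w.re - 1) * Real.exp (-(y * x))) := by
        intro x hx
        rw [hF2]
        simp only [norm_mul, Complex.norm_cpow_eq_rpow_re_of_pos hx,
          Complex.norm_cpow_eq_rpow_re_of_pos hy, Complex.norm_exp]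
        simp
      simp only
      rw [setIntegral_congr_fun measurableSet_Ioi h2, integral_const_mul,
        Real.integral_rpow_mul_exp_neg_mul_Ioi hw hy, one_div, Real.inv_rpow hy.le, ← Real.rpow_neg hy.le,
        one_mul, show a - w.re - 1 = (a - 1) + (-w.re) by ring, Real.rpow_add hy]
      ring
  have hL : ∀ x ∈ Set.Ioi (0 : ℝ), ∫ y, F (x, y) ∂μ =
      (x : ℂ) ^ (w - 1) * (((1 + x) ^ (-a) : ℝ) : ℂ) * Complex.Gamma a := by
    intro x hx
    have hx : 0 < x := hx
    have h1x : 0 < 1 + x := by linarith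
    simp only [hF]
    rw [integral_const_mul, hμ, Complex.integral_cpow_mul_exp_neg_mul_Ioi (by simpa using ha) h1x,
      mul_assoc, Real.rpow_neg h1x.le, ← Real.inv_rpow h1x.le, Complex.ofReal_cpow (by positivity)]
    simp
  have hR : ∀ y ∈ Set.Ioi (0 : ℝ), ∫ x, F (x, y) ∂μ =
      (y : ℂ) ^ ((a : ℂ) - w - 1) * Complex.exp (-((1 : ℝ) * y)) * Complex.Gamma w := by
    intro y hy
    have hy : 0 < y := hy
    have hy' : (y : ℂ) ≠ 0 := by exact_mod_cast hy.ne'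
    simp only [hF2]
    rw [integral_const_mul, hμ, Complex.integral_cpow_mul_exp_neg_mul_Ioi hw hy, one_div,
      show (a : ℂ) - w - 1 = (a - 1) + (-w) by ring, Complex.cpow_add _ _ hy', Complex.cpow_neg,
      Complex.inv_cpow]
    · push_cast; ring_nf
    · rw [Complex.arg_ofReal_of_nonneg hy.le]; exact Real.pi_pos.ne
  have hconv : MellinConvergent (fun x : ℝ => (((1 + x) ^ (-a) : ℝ) : ℂ)) w := by
    have h1 : IntegrableOn (fun x => (∫ y, F (x, y) ∂μ) * (Complex.Gamma a)⁻¹) (Set.Ioi 0) :=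
      hInt.integral_prod_left.mul_const _
    refine h1.congr_fun (fun x hx => ?_) measurableSet_Ioi
    simp only
    rw [hL x hx, mul_assoc, mul_inv_cancel₀ hΓ, mul_one, smul_eq_mul]
  refine ⟨hconv, ?_⟩
  rw [eq_div_iff hΓ, mellin, ← integral_mul_const]
  calc _ = ∫ x, ∫ y, F (x, y) ∂μ ∂μ :=
        setIntegral_congr_fun measurableSet_Ioi fun x hx => (hL x hx).symm
    _ = ∫ y, ∫ x, F (x, y) ∂μ ∂μ := integral_integral_swap hInt
    _ = ∫ y in Set.Ioi (0 : ℝ), (y : ℂ) ^ ((a : ℂ) - w - 1) * Complex.exp (-((1 : ℝ) * y)) *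
        Complex.Gamma w := setIntegral_congr_fun measurableSet_Ioi hR
    _ = _ := by
      rw [integral_mul_const, Complex.integral_cpow_mul_exp_neg_mul_Ioi (by simpa using hwa) one_pos]
      simp [mul_comm]

lemma continuous_Gamma_vertical {f : ℝ → ℂ} (hf : Continuous f) (hpos : ∀ t, 0 < (f t).re) :
    Continuous fun t => Complex.Gamma (f t) := by
  refine continuous_iff_continuousAt.2 fun t => ?_
  refine ContinuousAt.comp (g := Complex.Gamma) ?_ hf.continuousAt
  refine (Complex.differentiableAt_Gamma _ fun m h => ?_).continuousAt
  have := hpos t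
  rw [h] at this
  simp only [Complex.neg_re, Complex.natCast_re] at this
  linarith [m.cast_nonneg (α := ℝ)]

/-- Two steps of the functional equation give quadratic decay of `Γ` on vertical lines. -/
lemma exists_norm_Gamma_vertical_le {σ : ℝ} (hσ : 0 < σ) :
    ∃ C, ∀ t : ℝ, ‖Complex.Gamma (σ + t * Complex.I)‖ ≤ C * (1 + t ^ 2)⁻¹ := by
  -- The constant comes from `Γ(w) = Γ(w + 2) / (w (w + 1))` with `|w| ≥ c √(1 + t²)` and `|w + 1| ≥
  -- √(1 + t²)`.
  set c := min 1 σ with hc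
  have hc0 : 0 < c := lt_min one_pos hσ
  refine ⟨Real.Gamma (σ + 2) / c, fun t => ?_⟩
  set w : ℂ := σ + t * Complex.I with hw
  have hre : w.re = σ := by simp [hw]
  have him : w.im = t := by simp [hw]
  have hw0 : w ≠ 0 := fun h => by rw [h] at hre; simp at hre; linarith
  have hw1 : w + 1 ≠ 0 := fun h => by
    have := congrArg Complex.re h; simp [hre] at this; linarith
  have hG : Complex.Gamma (w + 2) = (w + 1) * w * Complex.Gamma w := by
    rw [show w + 2 = w + 1 + 1 by ring, Complex.Gamma_add_one _ hw1, Complex.Gamma_add_one _ hw0]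
    ring
  have hle : ‖Complex.Gamma (w + 2)‖ ≤ Real.Gamma (σ + 2) := by
    have := norm_Gamma_le_Gamma_re (s := w + 2) (by simp [hre]; linarith)
    simpa [hre] using this
  have hs : c * Real.sqrt (1 + t ^ 2) ≤ ‖w‖ := by
    refine le_of_sq_le_sq ?_ (norm_nonneg _)
    rw [mul_pow, Real.sq_sqrt (by positivity), Complex.sq_norm, Complex.normSq_apply, hre, him]
    have h1 : c * c ≤ 1 * 1 := mul_le_mul (min_le_left _ _) (min_le_left _ _) hc0.le zero_le_one
    have h2 : c * c ≤ σ * σ := mul_le_mul (min_le_right _ _) (min_le_right _ _) hc0.le hσ.le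
    nlinarith [mul_le_mul_of_nonneg_right h1 (sq_nonneg t)]
  have hs1 : Real.sqrt (1 + t ^ 2) ≤ ‖w + 1‖ := by
    refine le_of_sq_le_sq ?_ (norm_nonneg _)
    rw [Real.sq_sqrt (by positivity), Complex.sq_norm, Complex.normSq_apply]
    simp only [Complex.add_re, Complex.add_im, hre, him, Complex.one_re, Complex.one_im]
    nlinarith
  have hprod : c * (1 + t ^ 2) ≤ ‖w + 1‖ * ‖w‖ := by
    calc c * (1 + t ^ 2) = Real.sqrt (1 + t ^ 2) * (c * Real.sqrt (1 + t ^ 2)) := by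
          rw [mul_left_comm, Real.mul_self_sqrt (by positivity)]
      _ ≤ _ := mul_le_mul hs1 hs (by positivity) (norm_nonneg _)
  rw [hG, norm_mul, norm_mul] at hle
  rw [div_mul_eq_mul_div, le_div_iff₀ hc0, ← div_eq_mul_inv, le_div_iff₀ (by positivity)]
  calc _ = c * (1 + t ^ 2) * ‖Complex.Gamma w‖ := by ring
    _ ≤ ‖w + 1‖ * ‖w‖ * ‖Complex.Gamma w‖ := by gcongr
    _ ≤ _ := hle

/-- The first factor decays quadratically and the second is bounded by `Γ(a - σ)`. -/
lemma integrable_Gamma_mul_Gamma_vertical {a σ : ℝ} (hσ : 0 < σ) (hσa : σ < a) :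
    Integrable fun t : ℝ => Complex.Gamma (σ + t * Complex.I) *
      Complex.Gamma (a - (σ + t * Complex.I)) := by
  obtain ⟨C, hC⟩ := exists_norm_Gamma_vertical_le hσ
  refine ((integrable_inv_one_add_sq.const_mul C).mul_const (Real.Gamma (a - σ))).mono' ?_ ?_
  · refine Continuous.aestronglyMeasurable (.mul ?_ ?_)
    · exact continuous_Gamma_vertical (by fun_prop) fun t => by simpa using hσ
    · exact continuous_Gamma_vertical (by fun_prop) fun t => by simpa using hσa
  · refine .of_forall fun t => ?_
    rw [norm_mul]
    refine mul_le_mul (hC t) ?_ (norm_nonneg _) ((norm_nonneg _).trans (hC t))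
    have := norm_Gamma_le_Gamma_re (s := a - (σ + t * Complex.I)) (by simpa using hσa)
    simpa using this

/-- The Mellin–Barnes representation of `(1 + x) ^ (-a)`. -/
lemma integral_Gamma_mul_Gamma_mul_cpow {a σ x : ℝ} (hσ : 0 < σ) (hσa : σ < a) (hx : 0 < x) :
    ∫ t : ℝ, Complex.Gamma (σ + t * Complex.I) * Complex.Gamma (a - (σ + t * Complex.I)) *
      (x : ℂ) ^ (-(σ + t * Complex.I)) =
      2 * Real.pi * Complex.Gamma a * (((1 + x) ^ (-a) : ℝ) : ℂ) := by
  have hΓ : Complex.Gamma a ≠ 0 :=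
    Complex.Gamma_ne_zero_of_re_pos (by simpa using hσ.trans hσa)
  have hm : ∀ t : ℝ, mellin (fun x : ℝ => (((1 + x) ^ (-a) : ℝ) : ℂ)) (σ + t * Complex.I) =
      Complex.Gamma (σ + t * Complex.I) * Complex.Gamma (a - (σ + t * Complex.I)) /
        Complex.Gamma a := fun t =>
    (hasMellin_one_add_rpow_neg (w := σ + t * Complex.I) (by simpa using hσ)
      (by simpa using hσa)).2
  have hcont : ContinuousAt (fun x : ℝ => (((1 + x) ^ (-a) : ℝ) : ℂ)) x := by
    refine Complex.continuous_ofReal.continuousAt.comp ?_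
    exact ContinuousAt.rpow_const (by fun_prop) (Or.inl (by positivity))
  have hinv := mellinInv_mellin_eq σ (fun x : ℝ => (((1 + x) ^ (-a) : ℝ) : ℂ)) hx
    (hasMellin_one_add_rpow_neg (w := σ) (by simpa using hσ) (by simpa using hσa)).1
    (by
      simp only [Complex.VerticalIntegrable, hm]
      exact (integrable_Gamma_mul_Gamma_vertical hσ hσa).div_const _) hcont
  rw [← hinv, mellinInv]
  simp only [hm, smul_eq_mul]
  rw [Complex.real_smul]
  have hpi : (Real.pi : ℂ) ≠ 0 := by exact_mod_cast Real.pi_ne_zero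
  calc _ = ∫ t : ℝ, Complex.Gamma a * ((x : ℂ) ^ (-(σ + t * Complex.I)) *
        (Complex.Gamma (σ + t * Complex.I) * Complex.Gamma (a - (σ + t * Complex.I)) /
        Complex.Gamma a)) := by
        congr 1; ext t; field_simp
    _ = _ := by 
      rw [integral_const_mul]
      generalize (∫ t : ℝ, _ : ℂ) = J
      push_cast
      field_simp

/-! ### The Fox kernel of the theorem and its Mellin–Barnes integral -/

lemma foxKernel_lomax (lam α : ℝ) (n : ℕ) (u : ℂ) :
    foxKernel 1 2 ![1 - (lam : ℂ), 1 - (n : ℂ)] ![1, α] ![1] ![1] u =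
      Complex.Gamma (1 + u) * Complex.Gamma (lam - u) * Complex.Gamma (n - α * u) := by
  have h1 : (Finset.univ.filter fun j : Fin 1 => j.val < 1) = Finset.univ := by decide
  have h2 : (Finset.univ.filter fun j : Fin 1 => 1 ≤ j.val) = ∅ := by decide
  have h3 : (Finset.univ.filter fun j : Fin 2 => j.val < 2) = Finset.univ := by decide
  have h4 : (Finset.univ.filter fun j : Fin 2 => 2 ≤ j.val) = ∅ := by decide
  rw [foxKernel, h1, h2, h3, h4]
  simp [Fin.prod_univ_two, mul_assoc]

/-- The poles are `-1 - k` on the left, `lam + k` and `(n + k)/α` on the right; those with `k = 0`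
are the binding ones. -/
lemma isSeparatingLine_lomax_iff {lam α : ℝ} (hα : 0 < α) (n : ℕ) (σ : ℝ) :
    IsSeparatingLine 1 2 ![1 - (lam : ℂ), 1 - (n : ℂ)] ![1, α] ![1] ![1] σ ↔
      -1 < σ ∧ σ < lam ∧ α * σ < n := by
  have hα' : (α : ℂ) ≠ 0 := by exact_mod_cast hα.ne'
  constructor
  · rintro ⟨hl, hr⟩
    refine ⟨?_, ?_, ?_⟩
    · simpa using hl (-1) ⟨0, by simp, 0, by simp⟩
    · simpa using hr lam ⟨0, by simp, 0, by simp⟩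
    · have := hr ((n / α : ℝ) : ℂ) ⟨1, by simp, 0, by simp; field_simp; simp⟩
      rw [Complex.ofReal_re, lt_div_iff₀ hα] at this
      linarith
  · rintro ⟨h1, h2, h3⟩
    refine ⟨?_, ?_⟩
    · rintro u ⟨j, -, k, hk⟩
      have := congrArg Complex.re hk
      have hk0 : (0 : ℝ) ≤ k := k.cast_nonneg
      simp at this
      linarith
    · rintro u ⟨j, -, k, hk⟩
      have := congrArg Complex.re hk
      have hk0 : (0 : ℝ) ≤ k := k.cast_nonneg
      fin_cases j
      · simp at this
        linarith
      · simp at this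
        nlinarith

/-- The Mellin–Barnes integral of a generalized moment generating function of Lomax type. -/
lemma integrable_foxIntegrand_lomax {α lam c s σ : ℝ} (hc : 0 < c)
    (hs : 0 < s) (n : ℕ) (h1 : -1 < σ) (h2 : σ < lam) (h3 : α * σ < n) :
    Integrable (foxIntegrand 1 2 ![1 - (lam : ℂ), 1 - (n : ℂ)] ![1, α] ![1] ![1]
      ((c / s ^ α : ℝ) : ℂ) σ) ∧
    ∫ t : ℝ, foxIntegrand 1 2 ![1 - (lam : ℂ), 1 - (n : ℂ)] ![1, α] ![1] ![1]
      ((c / s ^ α : ℝ) : ℂ) σ t =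
    2 * Real.pi * ((s ^ n * Real.Gamma (lam + 1) * ∫ γ in Set.Ioi (0 : ℝ),
      γ ^ n * (c * γ ^ (α - 1) * (1 + c * γ ^ α) ^ (-(lam + 1))) * Real.exp (-(γ * s)) : ℝ) : ℂ) := by
  set K : ℝ → ℂ := fun t => Complex.Gamma (1 + (σ + t * Complex.I)) *
    Complex.Gamma (lam - (σ + t * Complex.I)) with hK
  -- Shifting the line by one puts `K` in beta form with `a = lam + 1` and abscissa `1 + σ`.
  have hKeq : ∀ t : ℝ, K t = Complex.Gamma ((1 + σ : ℝ) + t * Complex.I) *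
      Complex.Gamma ((lam + 1 : ℝ) - ((1 + σ : ℝ) + t * Complex.I)) := by
    intro t
    simp only [hK]
    congr 2 <;> push_cast <;> ring
  have hKint : Integrable K := by
    simp only [funext hKeq]
    exact integrable_Gamma_mul_Gamma_vertical (by linarith) (by linarith)
  have hKmeas : Measurable K := by
    refine (Continuous.mul ?_ ?_).measurable
    · exact continuous_Gamma_vertical (by fun_prop) fun t => by simp; linarith
    · exact continuous_Gamma_vertical (by fun_prop) fun t => by simpa using h2
  set μ : Measure ℝ := volume.restrict (Set.Ioi 0) with hμ
  -- Integration in `γ` gives the Fox integrand up to `s^(-n)`; integration in `t` gives the Lomax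
  -- density by Mellin inversion.
  set F : ℝ × ℝ → ℂ := fun p => K p.2 * ((c : ℂ) ^ (-(σ + p.2 * Complex.I)) *
    ((p.1 : ℂ) ^ ((n : ℂ) - α * (σ + p.2 * Complex.I) - 1) * Complex.exp (-(s * p.1)))) with hF
  have hmeas : Measurable F := by fun_prop
  have hn : ∀ t : ℝ, ((n : ℂ) - α * (σ + t * Complex.I)).re = n - α * σ := by intro t; simp
  have hInt : Integrable F (μ.prod volume) := by
    -- The norms of the powers depend only on `σ`, so the majorant is a product; `ασ < n` makes its
    -- first factor integrable at `0`.
    have hb : Integrable (fun p : ℝ × ℝ => (c ^ (-σ) * (p.1 ^ (n - α * σ - 1) *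
        Real.exp (-(s * p.1)))) * ‖K p.2‖) (μ.prod volume) :=
      Integrable.mul_prod ((integrableOn_rpow_mul_exp_neg_mul (sub_pos.2 h3) hs).const_mul _)
        hKint.norm
    refine hb.mono' hmeas.aestronglyMeasurable ?_
    have hae : ∀ᵐ p ∂(μ.prod (volume : Measure ℝ)), p.1 ∈ Set.Ioi (0 : ℝ) :=
      Measure.quasiMeasurePreserving_fst.ae (ae_restrict_mem measurableSet_Ioi)
    filter_upwards [hae] with p hp
    simp only [hF, norm_mul]
    rw [Complex.norm_cpow_eq_rpow_re_of_pos hc, Complex.norm_cpow_eq_rpow_re_of_pos hp,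
      Complex.norm_exp, Complex.sub_re, hn]
    simp [mul_comm]
  have hfox : ∀ t : ℝ, ∫ γ, F (γ, t) ∂μ = ((s : ℂ) ^ n)⁻¹ *
      foxIntegrand 1 2 ![1 - (lam : ℂ), 1 - (n : ℂ)] ![1, α] ![1] ![1]
      ((c / s ^ α : ℝ) : ℂ) σ t := by
    intro t
    simp only [hF]
    rw [integral_const_mul, integral_const_mul, hμ,
      Complex.integral_cpow_mul_exp_neg_mul_Ioi (by rw [hn]; linarith) hs, foxIntegrand,
      foxKernel_lomax]
    set u : ℂ := σ + t * Complex.I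
    have hs' : (s : ℂ) ≠ 0 := by exact_mod_cast hs.ne'
    have e1 : (1 / (s : ℂ)) ^ ((n : ℂ) - α * u) = ((s : ℂ) ^ n)⁻¹ * (s : ℂ) ^ (α * u) := by
      rw [one_div, Complex.inv_cpow _ _ (by
        rw [Complex.arg_ofReal_of_nonneg hs.le]; exact Real.pi_pos.ne), ← Complex.cpow_neg,
        show -((n : ℂ) - α * u) = -(n : ℂ) + α * u by ring, Complex.cpow_add _ _ hs',
        Complex.cpow_neg, Complex.cpow_natCast]
    have e2 : ((c / s ^ α : ℝ) : ℂ) ^ (-u) = (c : ℂ) ^ (-u) * (s : ℂ) ^ (α * u) := by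
      rw [div_eq_mul_inv, ← Real.rpow_neg hs.le, Complex.ofReal_mul,
        Complex.mul_cpow_ofReal_nonneg hc.le (Real.rpow_nonneg hs.le _),
        Complex.cpow_def_of_ne_zero (x := ((s ^ (-α) : ℝ) : ℂ))
          (by exact_mod_cast (Real.rpow_pos_of_pos hs _).ne'),
        ← Complex.ofReal_log (Real.rpow_nonneg hs.le _), Real.log_rpow hs,
        Complex.cpow_def_of_ne_zero hs', ← Complex.ofReal_log hs.le]
      congr 2
      push_cast; ring
    rw [e1, e2]
    simp only [hK]
    ring
  have hmell : ∀ γ ∈ Set.Ioi (0 : ℝ), ∫ t, F (γ, t) = ((2 * Real.pi * Real.Gamma (lam + 1) *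
      (γ ^ n * (c * γ ^ (α - 1) * (1 + c * γ ^ α) ^ (-(lam + 1))) * Real.exp (-(γ * s))) : ℝ) : ℂ) := by
    intro γ hγ
    have hγ : 0 < γ := hγ
    have hγ' : (γ : ℂ) ≠ 0 := by exact_mod_cast hγ.ne'
    have hγα : 0 < γ ^ α := Real.rpow_pos_of_pos hγ α
    have hx : 0 < c * γ ^ α := by positivity
    have hx' : ((c * γ ^ α : ℝ) : ℂ) ≠ 0 := by exact_mod_cast hx.ne'
    have hinv := integral_Gamma_mul_Gamma_mul_cpow (a := lam + 1) (σ := 1 + σ) (x := c * γ ^ α)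
      (by linarith) (by linarith) hx
    -- The prefactor `c γ^α` compensates for the exponent `-(1 + u)` replacing `-u`.
    have hFt : ∀ t, F (γ, t) = (((c * γ ^ α) * γ ^ n / γ * Real.exp (-(γ * s)) : ℝ) : ℂ) *
        (Complex.Gamma ((1 + σ : ℝ) + t * Complex.I) *
      Complex.Gamma ((lam + 1 : ℝ) - ((1 + σ : ℝ) + t * Complex.I)) *
      ((c * γ ^ α : ℝ) : ℂ) ^ (-((1 + σ : ℝ) + t * Complex.I))) := by
      intro t
      rw [← hKeq]
      simp only [hF]
      have e1 : ((1 + σ : ℝ) : ℂ) + t * Complex.I = 1 + (σ + t * Complex.I) := by push_cast; ring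
      rw [e1]
      set u : ℂ := σ + t * Complex.I
      have e2 : (γ : ℂ) ^ ((n : ℂ) - α * u - 1) = (γ : ℂ) ^ n * (γ : ℂ) ^ (-(α * u)) / γ := by
        rw [show (n : ℂ) - α * u - 1 = n + (-(α * u)) - 1 by ring, Complex.cpow_sub _ _ hγ',
          Complex.cpow_add _ _ hγ', Complex.cpow_natCast, Complex.cpow_one]
      have e3 : ((c * γ ^ α : ℝ) : ℂ) ^ (-(1 + u)) = ((c * γ ^ α : ℝ) : ℂ)⁻¹ *
          ((c : ℂ) ^ (-u) * (γ : ℂ) ^ (-(α * u))) := by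
        rw [neg_add, Complex.cpow_add _ _ hx', Complex.cpow_neg_one, Complex.ofReal_mul,
          Complex.mul_cpow_ofReal_nonneg hc.le hγα.le]
        congr 2
        rw [Complex.cpow_def_of_ne_zero (x := ((γ ^ α : ℝ) : ℂ))
          (by exact_mod_cast hγα.ne'),
          ← Complex.ofReal_log hγα.le, Real.log_rpow hγ,
          Complex.cpow_def_of_ne_zero hγ', ← Complex.ofReal_log hγ.le]
        congr 1
        push_cast; ring
      rw [e2, e3]
      set x := c * γ ^ α
      push_cast
      rw [mul_comm (s : ℂ) γ]
      field_simp
    simp only [hFt]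
    rw [integral_const_mul, hinv, Real.rpow_sub_one hγ.ne', Complex.Gamma_ofReal]
    push_cast
    ring
  have hs' : (s : ℂ) ^ n ≠ 0 := pow_ne_zero _ (by exact_mod_cast hs.ne')
  have hfox' : ∀ t : ℝ, foxIntegrand 1 2 ![1 - (lam : ℂ), 1 - (n : ℂ)] ![1, α] ![1] ![1]
      ((c / s ^ α : ℝ) : ℂ) σ t = (s : ℂ) ^ n * ∫ γ, F (γ, t) ∂μ := by
    intro t
    rw [hfox, mul_inv_cancel_left₀ hs']
  constructor
  -- Absolute convergence along the line is inherited from `F` as a partial integral.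
  · rw [funext hfox']
    exact hInt.integral_prod_right.const_mul _
  · simp only [hfox']
    rw [integral_const_mul, ← integral_integral_swap (f := fun γ t => F (γ, t)) hInt,
      setIntegral_congr_fun measurableSet_Ioi hmell, integral_complex_ofReal, integral_const_mul]
    push_cast
    ring

/-! ### The law of the signal power -/

/-- The substitution `v = k x^p`, used for the squared radius (`k = 1`, `p = 2`) and for passing
from power to SNR (`p = α`). -/
lemma lintegral_Ioi_eq_lintegral_comp_mul_rpow {k p : ℝ} (hk : 0 < k) (hp : 0 < p)
    (g : ℝ → ENNReal) :
    ∫⁻ v in Set.Ioi 0, g v =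
      ∫⁻ x in Set.Ioi 0, ENNReal.ofReal (k * p * x ^ (p - 1)) * g (k * x ^ p) := by
  have himg : (fun x : ℝ => k * x ^ p) '' Set.Ioi 0 = Set.Ioi 0 := by
    ext v
    constructor
    · rintro ⟨x, hx, rfl⟩
      exact mul_pos hk (Real.rpow_pos_of_pos hx p)
    · intro hv
      have hv : 0 < v / k := div_pos hv hk
      refine ⟨(v / k) ^ p⁻¹, Real.rpow_pos_of_pos hv _, ?_⟩
      simp only
      rw [Real.rpow_inv_rpow hv.le hp.ne', mul_div_cancel₀ _ hk.ne']
  have hinj : Set.InjOn (fun x : ℝ => k * x ^ p) (Set.Ioi 0) := fun x hx y hy h =>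
    Real.rpow_left_injOn hp.ne' (Set.mem_Ioi.1 hx).le (Set.mem_Ioi.1 hy).le
      (mul_left_cancel₀ hk.ne' h)
  have hderiv : ∀ x ∈ Set.Ioi (0 : ℝ), HasDerivWithinAt (fun x : ℝ => k * x ^ p)
      (k * (p * x ^ (p - 1))) (Set.Ioi 0) x := fun x hx =>
    ((Real.hasDerivAt_rpow_const (Or.inl (Set.mem_Ioi.1 hx).ne')).const_mul k).hasDerivWithinAt
  have h := lintegral_image_eq_lintegral_abs_deriv_mul measurableSet_Ioi hderiv hinj g
  rw [himg] at h
  rw [h]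
  refine setLIntegral_congr_fun measurableSet_Ioi fun x hx => ?_
  have : 0 < x ^ (p - 1) := Real.rpow_pos_of_pos hx _
  rw [abs_of_pos (by positivity), mul_assoc]

lemma gaussianPDF_mul_gaussianPDF {t : ℝ} (ht : 0 < t) (x y : ℝ) :
    gaussianPDF 0 (1 / (2 * t)).toNNReal x * gaussianPDF 0 (1 / (2 * t)).toNNReal y =
      ENNReal.ofReal (t / Real.pi * Real.exp (-(t * (x ^ 2 + y ^ 2)))) := by
  have hpi := Real.pi_pos
  rw [gaussianPDF_def, ← ENNReal.ofReal_mul (gaussianPDFReal_nonneg _ _ _), gaussianPDFReal_def]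
  congr 1
  simp only
  rw [Real.coe_toNNReal _ (by positivity), mul_mul_mul_comm, ← Real.exp_add, ← mul_inv,
    Real.mul_self_sqrt (by positivity)]
  congr 1
  · field_simp
  · congr 1; field_simp; ring

/-- The squared norm of a centred planar Gaussian with variance `1 / (2 t)` per coordinate is
exponentially distributed with rate `t`. -/
lemma lintegral_gaussianReal_prod_sq_add_sq {t : ℝ} (ht : 0 < t) {g : ℝ → ENNReal}
    (hg : Measurable g) :
    ∫⁻ p, g (p.1 ^ 2 + p.2 ^ 2) ∂((gaussianReal 0 (1 / (2 * t)).toNNReal).prod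
      (gaussianReal 0 (1 / (2 * t)).toNNReal)) =
      ∫⁻ v in Set.Ioi 0, ENNReal.ofReal (t * Real.exp (-(t * v))) * g v := by
  have hpi := Real.pi_pos
  have hv : (1 / (2 * t)).toNNReal ≠ 0 := by
    have : 0 < 1 / (2 * t) := by positivity
    exact (Real.toNNReal_pos.2 this).ne'
  rw [gaussianReal_of_var_ne_zero _ hv, prod_withDensity (by fun_prop) (by fun_prop),
    lintegral_withDensity_eq_lintegral_mul _ (by fun_prop) (by fun_prop)]
  simp only [Pi.mul_apply, gaussianPDF_mul_gaussianPDF ht]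
  rw [← Measure.volume_eq_prod, ← lintegral_comp_polarCoord_symm, polarCoord_target,
    Measure.volume_eq_prod, ← Measure.prod_restrict]
  have hpol : ∀ p : ℝ × ℝ, (polarCoord.symm p).1 ^ 2 + (polarCoord.symm p).2 ^ 2 = p.1 ^ 2 := by
    intro p
    rw [polarCoord_symm_apply]
    linear_combination p.1 ^ 2 * Real.sin_sq_add_cos_sq p.2
  simp only [hpol, smul_eq_mul]
  -- The angle contributes `2π`; with `v = r²`, the weight `2π · r · t/π` becomes `t · 2r`, that is
  -- `t dv`.
  rw [lintegral_prod _ (by fun_prop), lintegral_Ioi_eq_lintegral_comp_mul_rpow one_pos two_pos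
    fun v => ENNReal.ofReal (t * Real.exp (-(t * v))) * g v]
  refine setLIntegral_congr_fun measurableSet_Ioi fun r hr => ?_
  have hr : 0 < r := hr
  simp only [lintegral_const, Measure.restrict_apply_univ, Real.volume_Ioo, one_mul, Real.rpow_two]
  rw [mul_comm, ← mul_assoc, ← mul_assoc, ← mul_assoc, ← ENNReal.ofReal_mul (by linarith),
    ← ENNReal.ofReal_mul (by nlinarith), ← ENNReal.ofReal_mul (by positivity)]
  congr 2
  rw [show (2 : ℝ) - 1 = 1 by norm_num, Real.rpow_one]
  field_simp
  ring

/-- The density on `(0, ∞)` of the signal power in Lomax fading. -/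
noncomputable def powerPDF (lam β v : ℝ) : ℝ :=
  lam * β ^ lam * (β + v) ^ (-(lam + 1))

@[fun_prop]
lemma measurable_powerPDF (lam β : ℝ) : Measurable (powerPDF lam β) := by
  unfold powerPDF; fun_prop

/-- The factor `t exp(-tv)` moves the Gamma shape to `lam + 1` and the rate to `β + v`; the
normalisations leave `Γ(lam + 1) / Γ(lam) = lam`. -/
lemma lintegral_gammaMeasure_exponential {lam β v : ℝ} (hlam : 0 < lam) (hβ : 0 < β)
    (hv : 0 < v) :
    ∫⁻ t, ENNReal.ofReal (t * Real.exp (-(t * v))) ∂(gammaMeasure lam β) =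
      ENNReal.ofReal (powerPDF lam β v) := by
  have hΓ : 0 < Real.Gamma lam := Real.Gamma_pos_of_pos hlam
  have hβv : 0 < β + v := by linarith
  have hint : IntegrableOn (fun t : ℝ => β ^ lam / Real.Gamma lam *
      (t ^ ((lam + 1) - 1) * Real.exp (-((β + v) * t)))) (Set.Ioi 0) :=
    (integrableOn_rpow_mul_exp_neg_mul (by linarith) hβv).const_mul _
  have hgp : Measurable (gammaPDF lam β) := (measurable_gammaPDFReal lam β).ennreal_ofReal
  rw [gammaMeasure, lintegral_withDensity_eq_lintegral_mul _ hgp (by fun_prop)]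
  calc _ = ∫⁻ t in Set.Ioi 0, ENNReal.ofReal (β ^ lam / Real.Gamma lam *
      (t ^ ((lam + 1) - 1) * Real.exp (-((β + v) * t)))) := by
        rw [← lintegral_indicator measurableSet_Ioi]
        congr 1; ext t
        by_cases ht : 0 < t
        · rw [Set.indicator_of_mem (Set.mem_Ioi.2 ht), Pi.mul_apply, gammaPDF_of_nonneg ht.le,
            ← ENNReal.ofReal_mul (by positivity), add_sub_cancel_right,
            show -((β + v) * t) = -(β * t) + -(t * v) by ring, Real.exp_add]
          congr 1
          rw [Real.rpow_sub_one ht.ne']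
          field_simp
        · rw [Set.indicator_of_notMem (by simpa using ht), Pi.mul_apply,
            ENNReal.ofReal_of_nonpos (p := t * _), mul_zero]
          exact mul_nonpos_of_nonpos_of_nonneg (not_lt.1 ht) (Real.exp_pos _).le
    _ = _ := by
        rw [← ofReal_integral_eq_lintegral_ofReal hint]
        · rw [integral_const_mul, Real.integral_rpow_mul_exp_neg_mul_Ioi (by linarith) hβv,
            Real.Gamma_add_one hlam.ne', powerPDF, one_div, Real.inv_rpow hβv.le,
            ← Real.rpow_neg hβv.le]
          congr 1
          field_simp
        · refine (ae_restrict_iff' measurableSet_Ioi).2 (.of_forall fun t ht => ?_)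
          have ht : 0 < t := ht
          simp only [Pi.zero_apply]
          positivity

variable {Ω : Type*} [MeasurableSpace Ω] {P : Measure Ω} [IsProbabilityMeasure P]
  {lam β : ℝ} {τ X Y : Ω → ℝ}

/-- The signal power of Lomax fading has density `powerPDF` on `(0, ∞)`. -/
lemma IsLomaxFading.lintegral_power (h : IsLomaxFading P lam β τ X Y) (hlam : 0 < lam)
    (hβ : 0 < β) {g : ℝ → ENNReal} (hg : Measurable g) :
    ∫⁻ ω, g (X ω ^ 2 + Y ω ^ 2) ∂P =
      ∫⁻ v in Set.Ioi 0, ENNReal.ofReal (powerPDF lam β v) * g v := by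
  have := isProbabilityMeasure_gammaMeasure hlam hβ
  have hXY : AEMeasurable (fun ω => (X ω, Y ω)) P :=
    h.aemeasurable_fst.prodMk h.aemeasurable_snd
  have hG : Measurable fun p : ℝ × ℝ => g (p.1 ^ 2 + p.2 ^ 2) := by fun_prop
  -- The point `0` is discarded as a null set, since the density need not vanish there.
  have hpos : ∀ᵐ t ∂(gammaMeasure lam β), 0 < t := by
    have hgp : Measurable (gammaPDF lam β) := (measurable_gammaPDFReal lam β).ennreal_ofReal
    rw [gammaMeasure, ae_withDensity_iff hgp]
    filter_upwards [Measure.ae_ne volume (0 : ℝ)] with t ht h0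
    refine lt_of_le_of_ne (not_lt.1 fun hlt => h0 (gammaPDF_of_neg hlt)) ht.symm
  have hcond := h.condDistrib_eq
  rw [h.hasLaw.map_eq] at hcond
  calc ∫⁻ ω, g (X ω ^ 2 + Y ω ^ 2) ∂P
      = ∫⁻ p, g (p.1 ^ 2 + p.2 ^ 2) ∂(P.map fun ω => (X ω, Y ω)) :=
        (lintegral_map' hG.aemeasurable hXY).symm
    _ = ∫⁻ t, ∫⁻ p, g (p.1 ^ 2 + p.2 ^ 2) ∂(condDistrib (fun ω => (X ω, Y ω)) τ P t)
          ∂(gammaMeasure lam β) := by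
        rw [← condDistrib_comp_map h.hasLaw.aemeasurable hXY,
          Measure.lintegral_bind (Kernel.aemeasurable _) hG.aemeasurable, h.hasLaw.map_eq]
    _ = ∫⁻ t, (∫⁻ v in Set.Ioi 0, ENNReal.ofReal (t * Real.exp (-(t * v))) * g v)
          ∂(gammaMeasure lam β) := by
        refine lintegral_congr_ae ?_
        filter_upwards [hcond, hpos] with t ht ht0
        rw [ht, lintegral_gaussianReal_prod_sq_add_sq ht0 hg]
    _ = ∫⁻ v in Set.Ioi 0, ∫⁻ t, ENNReal.ofReal (t * Real.exp (-(t * v))) * g v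
          ∂(gammaMeasure lam β) := by
        refine lintegral_lintegral_swap (Measurable.aemeasurable ?_)
        unfold Function.uncurry
        fun_prop
    _ = _ := by
        refine setLIntegral_congr_fun measurableSet_Ioi fun v hv => ?_
        rw [lintegral_mul_const _ (by fun_prop), lintegral_gammaMeasure_exponential hlam hβ hv]

/-! ### The mean gain and the law of the SNR -/

/-- Scaling `v = βx` extracts `β^p`; what remains is the beta integral with `a = lam + 1`, `w = 1 +
p`. The case `p = 1/α` gives the mean gain. -/
lemma integral_powerPDF_mul_rpow {p : ℝ} (hp : 0 < p) (hplam : p < lam) (hβ : 0 < β) :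
    ∫ v in Set.Ioi 0, powerPDF lam β v * v ^ p =
      β ^ p * (Real.Gamma (1 + p) * Real.Gamma (lam - p) / Real.Gamma lam) := by
  have hlam : 0 < lam := hp.trans hplam
  have hΓ : 0 < Real.Gamma lam := Real.Gamma_pos_of_pos hlam
  have hm : ∫ x in Set.Ioi (0 : ℝ), x ^ p * (1 + x) ^ (-(lam + 1)) =
      Real.Gamma (1 + p) * Real.Gamma (lam - p) / Real.Gamma (lam + 1) := by
    have h := (hasMellin_one_add_rpow_neg (a := lam + 1) (w := ((1 + p : ℝ) : ℂ))
      (by rw [Complex.ofReal_re]; linarith) (by rw [Complex.ofReal_re]; linarith)).2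
    rw [← Complex.ofReal_sub, Complex.Gamma_ofReal, Complex.Gamma_ofReal, Complex.Gamma_ofReal,
      mellin] at h
    rw [show lam - p = lam + 1 - (1 + p) by ring, ← Complex.ofReal_inj]
    push_cast at h ⊢
    rw [← h, ← integral_complex_ofReal]
    refine setIntegral_congr_fun measurableSet_Ioi fun x hx => ?_
    simp only [add_sub_cancel_left, smul_eq_mul, Complex.ofReal_mul,
      Complex.ofReal_cpow (Set.mem_Ioi.1 hx).le]
  have hsub := integral_comp_mul_left_Ioi (fun v => powerPDF lam β v * v ^ p) 0 hβ
  rw [mul_zero, smul_eq_mul, eq_inv_mul_iff_mul_eq₀ hβ.ne'] at hsub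
  rw [← hsub]
  have hpt : ∀ x ∈ Set.Ioi (0 : ℝ), powerPDF lam β (β * x) * (β * x) ^ p =
      (lam * β ^ p / β) * (x ^ p * (1 + x) ^ (-(lam + 1))) := by
    intro x hx
    have hx : 0 < x := hx
    rw [powerPDF, show β + β * x = β * (1 + x) by ring, Real.mul_rpow hβ.le (by linarith),
      Real.mul_rpow hβ.le hx.le, neg_add, Real.rpow_add hβ, Real.rpow_neg hβ.le, Real.rpow_neg_one]
    have : 0 < β ^ lam := Real.rpow_pos_of_pos hβ _
    field_simp
  rw [setIntegral_congr_fun measurableSet_Ioi hpt, integral_const_mul, hm,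
    Real.Gamma_add_one hlam.ne']
  field_simp

variable {α : ℝ}

lemma zeta_pos (hα : 0 < α) (hlam : 1 / α < lam) : 0 < zeta α lam := by
  have hα' : 0 < 1 / α := by positivity
  have h1 := Real.Gamma_pos_of_pos (s := 1 + 1 / α) (by linarith)
  have h2 := Real.Gamma_pos_of_pos (sub_pos.2 hlam)
  have h3 := Real.Gamma_pos_of_pos (hα'.trans hlam)
  unfold zeta
  positivity

/-- The mean of the `α`-Lomax variable. -/
lemma IsLomaxFading.integral_fadingGain (h : IsLomaxFading P lam β τ X Y) (hα : 0 < α)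
    (hlam : 1 / α < lam) (hβ : 0 < β) :
    ∫ ω, fadingGain α X Y ω ∂P = (β * zeta α lam) ^ (1 / α) := by
  have hα' : 0 < 1 / α := by positivity
  have hlam0 : 0 < lam := hα'.trans hlam
  have hX := h.aemeasurable_fst
  have hY := h.aemeasurable_snd
  have h1 := Real.Gamma_pos_of_pos (s := 1 + 1 / α) (by linarith)
  have h2 := Real.Gamma_pos_of_pos (sub_pos.2 hlam)
  have h3 := Real.Gamma_pos_of_pos hlam0
  have hpw : ∀ v ∈ Set.Ioi (0 : ℝ), 0 ≤ powerPDF lam β v * v ^ (1 / α) := by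
    intro v hv
    have hv : 0 < v := hv
    unfold powerPDF
    positivity
  rw [integral_eq_lintegral_of_nonneg_ae (.of_forall fun ω => by unfold fadingGain; positivity)
    (by unfold fadingGain; exact AEMeasurable.aestronglyMeasurable (by fun_prop))]
  simp only [fadingGain]
  rw [h.lintegral_power hlam0 hβ (g := fun v => ENNReal.ofReal (v ^ (1 / α))) (by fun_prop),
    Real.mul_rpow hβ.le (zeta_pos hα hlam).le, zeta, ← Real.rpow_mul (by positivity),
    mul_one_div_cancel hα.ne', Real.rpow_one, ← integral_powerPDF_mul_rpow hα' hlam hβ,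
    integral_eq_lintegral_of_nonneg_ae ((ae_restrict_iff' measurableSet_Ioi).2 (.of_forall hpw))
      (Measurable.aestronglyMeasurable (by fun_prop))]
  congr 1
  refine setLIntegral_congr_fun measurableSet_Ioi fun v hv => ?_
  have hv : 0 < v := hv
  rw [← ENNReal.ofReal_mul (by unfold powerPDF; positivity)]

lemma measurable_snrPDF (α lam γbar : ℝ) : Measurable (snrPDF α lam γbar) := by
  unfold snrPDF
  exact Measurable.ite measurableSet_Ioi (by fun_prop) measurable_const

lemma IsLomaxFading.aemeasurable_snr (h : IsLomaxFading P lam β τ X Y) (α γbar : ℝ) :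
    AEMeasurable (snr P α γbar X Y) P := by
  have hX := h.aemeasurable_fst
  have hY := h.aemeasurable_snd
  unfold snr fadingGain
  fun_prop

/-- The law of the instantaneous SNR. -/
lemma IsLomaxFading.map_snr (h : IsLomaxFading P lam β τ X Y) (hα : 0 < α)
    (hlam : 1 / α < lam) (hβ : 0 < β) {γbar : ℝ} (hγbar : 0 < γbar) :
    P.map (snr P α γbar X Y) =
      volume.withDensity fun γ => ENNReal.ofReal (snrPDF α lam γbar γ) := by
  have hα' : 0 < 1 / α := by positivity
  have hlam0 : 0 < lam := hα'.trans hlam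
  have hζ := zeta_pos hα hlam
  refine Measure.ext_of_lintegral _ fun g hg => ?_
  rw [lintegral_map' hg.aemeasurable (h.aemeasurable_snr α γbar),
    lintegral_withDensity_eq_lintegral_mul _ (measurable_snrPDF _ _ _).ennreal_ofReal hg]
  simp only [snr, fadingGain]
  have hmean : ∫ ω, (X ω ^ 2 + Y ω ^ 2) ^ (1 / α) ∂P = (β * zeta α lam) ^ (1 / α) :=
    h.integral_fadingGain hα hlam hβ
  simp only [hmean]
  -- The map `γ ↦ (β ζ / γbar^α) γ^α` inverts the passage from power to SNR.
  rw [h.lintegral_power hlam0 hβ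
    (g := fun v => g (γbar * (v ^ (1 / α) / (β * zeta α lam) ^ (1 / α)))) (by fun_prop),
    lintegral_Ioi_eq_lintegral_comp_mul_rpow (k := β * zeta α lam / γbar ^ α) (by positivity) hα,
    ← lintegral_indicator measurableSet_Ioi]
  congr 1; ext γ
  by_cases hγ : 0 < γ
  · rw [Set.indicator_of_mem (Set.mem_Ioi.2 hγ), Pi.mul_apply, ← mul_assoc,
      ← ENNReal.ofReal_mul (by positivity), snrPDF, if_pos hγ]
    congr 2
    · rw [powerPDF, show β + β * zeta α lam / γbar ^ α * γ ^ α =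
        β * (1 + zeta α lam / γbar ^ α * γ ^ α) by ring, Real.mul_rpow hβ.le (by positivity),
        neg_add, Real.rpow_add hβ, Real.rpow_neg hβ.le, Real.rpow_neg_one]
      have : 0 < β ^ lam := Real.rpow_pos_of_pos hβ _
      field_simp
    · rw [div_mul_eq_mul_div, mul_div_assoc, ← Real.div_rpow hγ.le hγbar.le,
        Real.mul_rpow (by positivity) (by positivity), ← Real.rpow_mul (by positivity) α,
        mul_one_div_cancel hα.ne', Real.rpow_one]
      field_simp
  · rw [Set.indicator_of_notMem (by simpa using hγ), Pi.mul_apply, snrPDF, if_neg hγ]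
    simp

/-! ### The value of the Fox function and the conclusion -/

/-- Any one separating line computes both the chosen value and `w`, so they agree. -/
lemma HasFoxH.foxH_eq {m n p q : ℕ} {a : Fin p → ℂ} {A : Fin p → ℝ} {b : Fin q → ℂ}
    {B : Fin q → ℝ} {z w : ℂ} (h : HasFoxH m n a A b B z w) : foxH m n a A b B z = w := by
  have hex : ∃ w, HasFoxH m n a A b B z w := ⟨w, h⟩
  obtain ⟨σ, hσ⟩ := h.1
  rw [foxH, dif_pos hex, ← (hex.choose_spec.2 σ hσ).2, (h.2 σ hσ).2]

lemma hasFoxH_lomax {α lam c s : ℝ} (hα : 0 < α) (hlam : 0 < lam) (hc : 0 < c) (hs : 0 < s)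
    (n : ℕ) :
    HasFoxH 1 2 ![1 - (lam : ℂ), 1 - (n : ℂ)] ![1, α] ![1] ![1] ((c / s ^ α : ℝ) : ℂ)
      ((s ^ n * Real.Gamma (lam + 1) * ∫ γ in Set.Ioi (0 : ℝ),
        γ ^ n * (c * γ ^ (α - 1) * (1 + c * γ ^ α) ^ (-(lam + 1))) * Real.exp (-(γ * s)) : ℝ) : ℂ) := by
  -- The abscissa `-1/2` works for every `n`, including `n = 0`, where the admissible strip is `-1 <
  -- σ < 0`.
  refine ⟨⟨-(1 / 2), (isSeparatingLine_lomax_iff hα n _).2 ⟨by norm_num, by linarith, ?_⟩⟩, ?_⟩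
  · have : (0 : ℝ) ≤ n := n.cast_nonneg
    linarith
  · intro σ hσ
    obtain ⟨h1, h2, h3⟩ := (isSeparatingLine_lomax_iff hα n σ).1 hσ
    obtain ⟨hint, heq⟩ := integrable_foxIntegrand_lomax hc hs n h1 h2 h3
    refine ⟨hint, ?_⟩
    have hpi : (Real.pi : ℂ) ≠ 0 := by exact_mod_cast Real.pi_ne_zero
    rw [heq, one_div, inv_mul_cancel_left₀ (mul_ne_zero two_ne_zero hpi)]

/-- The last power is at most `1`, so `c γ^(n + α - 1) exp(-sγ)` dominates. -/
lemma integrableOn_pow_mul_lomax_mul_exp {α lam c s : ℝ} (hα : 0 < α) (hlam : 0 < lam)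
    (hc : 0 < c) (hs : 0 < s) (n : ℕ) :
    IntegrableOn (fun γ : ℝ => γ ^ n * (c * γ ^ (α - 1) * (1 + c * γ ^ α) ^ (-(lam + 1))) *
      Real.exp (-(γ * s))) (Set.Ioi 0) := by
  have h := (integrableOn_rpow_mul_exp_neg_mul (a := n + α) (by positivity) hs).const_mul c
  refine h.mono' (Measurable.aestronglyMeasurable (by fun_prop))
    ((ae_restrict_iff' measurableSet_Ioi).2 (.of_forall fun γ hγ => ?_))
  have hγ : 0 < γ := hγ
  have hle : (1 + c * γ ^ α) ^ (-(lam + 1)) ≤ 1 :=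
    Real.rpow_le_one_of_one_le_of_nonpos (le_add_of_nonneg_right (by positivity)) (by linarith)
  rw [Real.norm_of_nonneg (by positivity), add_sub_assoc, Real.rpow_add hγ, Real.rpow_natCast]
  calc _ = c * (γ ^ n * γ ^ (α - 1) * Real.exp (-(s * γ))) * (1 + c * γ ^ α) ^ (-(lam + 1)) := by
        rw [mul_comm s γ]; ring
    _ ≤ _ := mul_le_of_le_one_right (by positivity) hle

end AlphaLomax

theorem lemma3 {Ω : Type*} [MeasurableSpace Ω] (P : Measure Ω) [IsProbabilityMeasure P]
    (α lam β γbar : ℝ) (hα : 0 < α) (hlam : 1 / α < lam) (hβ : 0 < β) (hγbar : 0 < γbar)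
    (τ X Y : Ω → ℝ) (hmodel : AlphaLomax.IsLomaxFading P lam β τ X Y)
    (n : ℕ) (s : ℝ) (hs : 0 < s) :
    HasPDF (AlphaLomax.snr P α γbar X Y) P volume ∧
    pdf (AlphaLomax.snr P α γbar X Y) P volume =ᵐ[volume]
      (fun γ => ENNReal.ofReal (AlphaLomax.snrPDF α lam γbar γ)) ∧
    IntegrableOn (AlphaLomax.genMGFIntegrand P (AlphaLomax.snr P α γbar X Y) n s)
      (Set.Ioi 0) volume ∧
    (∃ w : ℂ, AlphaLomax.HasFoxH 1 2 ![1 - (lam : ℂ), 1 - (n : ℂ)] ![1, α] ![1] ![1]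
      ((AlphaLomax.zeta α lam / (γbar ^ α * s ^ α) : ℝ) : ℂ) w) ∧
    (AlphaLomax.genMGF P (AlphaLomax.snr P α γbar X Y) n s : ℂ) =
      ((α / (s ^ n * Real.Gamma lam) : ℝ) : ℂ) *
        AlphaLomax.foxH 1 2 ![1 - (lam : ℂ), 1 - (n : ℂ)] ![1, α] ![1] ![1]
          ((AlphaLomax.zeta α lam / (γbar ^ α * s ^ α) : ℝ) : ℂ) := by
  have hlam0 : 0 < lam := (by positivity : 0 < 1 / α).trans hlam
  have hζ := AlphaLomax.zeta_pos hα hlam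
  have hΓ : 0 < Real.Gamma lam := Real.Gamma_pos_of_pos hlam0
  have hmap := hmodel.map_snr hα hlam hβ hγbar
  have hmeas := (AlphaLomax.measurable_snrPDF α lam γbar).ennreal_ofReal.aemeasurable (μ := volume)
  have hpdf : HasPDF (AlphaLomax.snr P α γbar X Y) P volume :=
    hasPDF_of_map_eq_withDensity (hmodel.aemeasurable_snr α γbar) _ hmeas hmap
  have hae := (pdf.eq_of_map_eq_withDensity _ hmeas).1 hmap
  set c := AlphaLomax.zeta α lam / γbar ^ α with hc
  have hc0 : 0 < c := by positivity
  have hcongr : AlphaLomax.genMGFIntegrand P (AlphaLomax.snr P α γbar X Y) n s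
      =ᵐ[volume.restrict (Set.Ioi 0)] fun γ => α * lam *
        (γ ^ n * (c * γ ^ (α - 1) * (1 + c * γ ^ α) ^ (-(lam + 1))) * Real.exp (-(γ * s))) := by
    filter_upwards [ae_restrict_of_ae hae, ae_restrict_mem measurableSet_Ioi] with γ hγ hγ0
    have hγ0 : 0 < γ := hγ0
    rw [AlphaLomax.genMGFIntegrand, hγ, AlphaLomax.snrPDF, if_pos hγ0, mul_div_assoc, ← hc,
      ENNReal.toReal_ofReal (by positivity)]
    ring
  have hfox := AlphaLomax.hasFoxH_lomax hα hlam0 hc0 hs n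
  rw [hc, div_div, ← hc] at hfox
  refine ⟨hpdf, hae, ?_, ⟨_, hfox⟩, ?_⟩
  · exact ((AlphaLomax.integrableOn_pow_mul_lomax_mul_exp hα hlam0 hc0 hs n).const_mul _).congr
      hcongr.symm
  -- The constants match because `Γ(lam + 1) = lam Γ(lam)`.
  · rw [hfox.foxH_eq, ← Complex.ofReal_mul, Complex.ofReal_inj, AlphaLomax.genMGF,
      integral_congr_ae hcongr, integral_const_mul, Real.Gamma_add_one hlam0.ne']
    generalize (∫ γ in Set.Ioi (0 : ℝ), _ : ℝ) = J
    field_simp
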